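/- Let $K$ be a field, let $n \ge 1$, let $S = K[x_1,\dots,x_n,y_1,\dots,y_n]$ with the standard grading, and let $P_n$ be the path with vertices $1,\dots,n$ and edges $\{i,i+1\}$ for $1 \le i \le n-1$. Let $J_{P_n} = (x_i y_{i+1} - x_{i+1} y_i : 1 \le i \le n-1) \subseteq S$ be its binomial edge ideal. Then the Hilbert series of $S/J_{P_n}$ is $$\sum_{k \ge 0} \dim_K (S/J_{P_n})_k \, t^k = \frac{(1+t)^{n-1}}{(1-t)^{n+1}}.$$ For a finitely generated graded $S$-module $M$ of Krull dimension $d$, the Hilbert coefficients $e_0(M), \dots, e_{d-1}(M)$ are the integers such that the polynomial $$P_M(X) = \sum_{i=0}^{d-1} (-1)^{d-1-i} e_{d-1-i}(M) \binom{X+i}{i}$$ satisfies $P_M(k) = \dim_K M_k$ for all sufficiently large $k$. The module $S/J_{P_n}$ has Krull dimension $n+1$, and its Hilbert coefficients are $$e_i(S/J_{P_n}) = \binom{n-1}{i} 2^{n-1-i} \quad (0 \le i \le n-1), \qquad e_n(S/J_{P_n}) = 0.$$ -/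

import Mathlib

namespace BinomialEdge

open MvPolynomial in
/-- The binomial edge ideal `J_G = (x_i y_j - x_j y_i : {i, j} ∈ E(G), i < j)` of a simple graph `G`
on `n` vertices, in `S = K[x_1, …, x_n, y_1, …, y_n]`. The variable `x_i` is `X (Sum.inl i)` and
the variable `y_i` is `X (Sum.inr i)`. -/
noncomputable def binomialEdgeIdeal (K : Type*) [Field K] {n : ℕ} (G : SimpleGraph (Fin n)) :
    Ideal (MvPolynomial (Fin n ⊕ Fin n) K) :=
  Ideal.span {f | ∃ i j : Fin n, i < j ∧ G.Adj i j ∧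
    f = X (Sum.inl i) * X (Sum.inr j) - X (Sum.inl j) * X (Sum.inr i)}

/-- The standard grading of a quotient `S / I` of a polynomial ring `S` by a homogeneous ideal `I`:
the component of degree `k` is the image of the forms of degree `k`
(every variable has degree one). -/
noncomputable def quotientGrading {K σ : Type*} [Field K] (I : Ideal (MvPolynomial σ K)) (k : ℕ) :
    Submodule K (MvPolynomial σ K ⧸ I) :=
  (MvPolynomial.homogeneousSubmodule σ K k).map (Ideal.Quotient.mkₐ K I).toLinearMap

section Hilbert

variable {K M : Type*} [Field K] [AddCommGroup M] [Module K M]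

/-- The Hilbert function `k ↦ l(M_k)` of a graded module whose components `M_k` have finite
length. -/
noncomputable def hilbertFunction (ℳ : ℕ → Submodule K M) (k : ℕ) : ℕ :=
  (Module.length K (ℳ k)).toNat

/-- The Hilbert series `∑ l(M_k) t^k`, as a formal power series with rational coefficients. -/
noncomputable def hilbertSeries (ℳ : ℕ → Submodule K M) : PowerSeries ℚ :=
  PowerSeries.mk fun k => (hilbertFunction ℳ k : ℚ)

/-- `P` is the Hilbert polynomial of the graded module: it has rational coefficients and
`H_M(k) = P(k)` for all large `k`. There is at most one such polynomial. -/
def IsHilbertPolynomial (ℳ : ℕ → Submodule K M) (P : Polynomial ℚ) : Prop :=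
  ∀ᶠ k : ℕ in Filter.atTop, (hilbertFunction ℳ k : ℚ) = P.eval (k : ℚ)

/-- `e = (e_0, …, e_{d-1})` is the family of Hilbert coefficients of the graded `S`-module `M`:
`d` is the Krull dimension of `M`, and the Hilbert polynomial of `M` is
`∑_{i < d} (-1)^{d-1-i} e_{d-1-i} binom(X + i, i)`.

Here `Fin.rev i` is the index `d-1-i`, and `Polynomial.preHilbertPoly ℚ i 0` is the polynomial
`binom(X + i, i) = (X + 1)(X + 2)⋯(X + i) / i!`. -/
def IsHilbertCoefficients (S : Type*) [CommRing S] [Module S M] (ℳ : ℕ → Submodule K M)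
    {d : ℕ} (e : Fin d → ℤ) : Prop :=
  Module.supportDim S M = d ∧
  IsHilbertPolynomial ℳ
    (∑ i : Fin d, ((-1 : ℚ) ^ (Fin.rev i : ℕ) * (e (Fin.rev i) : ℚ)) •
      Polynomial.preHilbertPoly ℚ (i : ℕ) 0)

end Hilbert

end BinomialEdge

/-! The generators `f_j = x_j y_{j+1} - x_{j+1} y_j` form a regular sequence. Let `I_m` be generated
by those with `j < m`. The variable `y_{m+1}` does not occur in `I_m`, and the top part of `f_m` in
that variable is `x_m y_{m+1}`, so it suffices that `x_m` is a nonzerodivisor modulo `I_m`. This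
follows by induction: setting `x_{m+1} = 0` turns `f_m` into `x_m y_{m+1}`, regular modulo `I_m`.

Each of the `n - 1` quadrics multiplies the Hilbert series by `1 - t^2`, starting from `1 / (1 -
t)^(2n)`, and lowers the dimension by at least one, so the dimension is at most `n + 1`. Equality
holds because `J` vanishes under `x_u ↦ s_u`, `y_u ↦ t s_u`, whose image has dimension at least `n +
1`.

Expanding `(1 + t)^(n-1) = (2 - (1 - t))^(n-1)` gives the Hilbert coefficients, which are unique
because the polynomials `binom(X + i, i)` are linearly independent. -/

namespace BinomialEdge

open MvPolynomial

/-! ### Nonzerodivisors modulo ideals of a polynomial ring -/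

section Regular

variable {K σ : Type*} [Field K]

attribute [local instance] MvPolynomial.weightedGradedAlgebra in
lemma weightedHomogeneousComponent_mul_of_right {w : σ → ℕ} {a : MvPolynomial σ K} {d : ℕ}
    (ha : IsWeightedHomogeneous w a d) (p : MvPolynomial σ K) (m : ℕ) :
    weightedHomogeneousComponent w (m + d) (p * a) = weightedHomogeneousComponent w m p * a := by
  have h := DirectSum.coe_decompose_mul_add_of_right_mem (weightedHomogeneousSubmodule K w)
    (a := p) (i := m) (j := d) ((mem_weightedHomogeneousSubmodule K w d a).2 ha)
  have key : ∀ (φ : MvPolynomial σ K) (i : ℕ),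
      (DirectSum.decompose (weightedHomogeneousSubmodule K w) φ i : MvPolynomial σ K) =
        weightedHomogeneousComponent w i φ :=
    fun φ i => weightedDecomposition.decompose'_apply K w φ i
  rwa [key, key] at h

attribute [local instance] MvPolynomial.weightedGradedAlgebra in
lemma weightedHomogeneousComponent_mul_of_lt {w : σ → ℕ} {a : MvPolynomial σ K} {d m : ℕ}
    (ha : IsWeightedHomogeneous w a d) (p : MvPolynomial σ K) (hm : m < d) :
    weightedHomogeneousComponent w m (p * a) = 0 := by
  have h := DirectSum.coe_decompose_mul_of_right_mem_of_not_le (weightedHomogeneousSubmodule K w)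
    (a := p) (n := m) (i := d) ((mem_weightedHomogeneousSubmodule K w d a).2 ha) (not_le.2 hm)
  exact (weightedDecomposition.decompose'_apply K w (p * a) m).symm.trans h

attribute [local instance] MvPolynomial.weightedGradedAlgebra in
lemma weightedHomogeneousComponent_mem_span {w : σ → ℕ} {T : Set (MvPolynomial σ K)}
    (hT : ∀ t ∈ T, ∃ d, IsWeightedHomogeneous w t d) {p : MvPolynomial σ K}
    (hp : p ∈ Ideal.span T) (m : ℕ) : weightedHomogeneousComponent w m p ∈ Ideal.span T :=
  weightedHomogeneousComponent_mem_of_mem K w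
    (Ideal.homogeneous_span _ _ fun t ht => hT t ht) hp m

/-- If the top weighted component `a` of `a + b` is a nonzerodivisor modulo a weighted homogeneous
ideal, then so is `a + b`. -/
lemma mem_of_mul_add_mem {w : σ → ℕ} {I : Ideal (MvPolynomial σ K)}
    (hI : ∀ p ∈ I, ∀ m, weightedHomogeneousComponent w m p ∈ I) {a b : MvPolynomial σ K}
    (ha : IsWeightedHomogeneous w a 1) (hb : IsWeightedHomogeneous w b 0)
    (hreg : ∀ p, p * a ∈ I → p ∈ I) {p : MvPolynomial σ K} (hp : p * (a + b) ∈ I) : p ∈ I := by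
  -- The component of `p * (a + b)` in degree `m + 1` is `p_m * a + p_{m+1} * b`. The components
  -- above the degree of `p` vanish, so descending induction puts all of them in `I`.
  have step : ∀ m, weightedHomogeneousComponent w (m + 1) p ∈ I →
      weightedHomogeneousComponent w m p ∈ I := by
    intro m hm
    apply hreg
    have h := hI _ hp (m + 1)
    rw [mul_add, map_add, weightedHomogeneousComponent_mul_of_right ha,
      weightedHomogeneousComponent_mul_of_right hb (m := m + 1)] at h
    exact (Ideal.add_mem_iff_left _ (I.mul_mem_right _ hm)).1 h
  have hall : ∀ k m, weightedTotalDegree w p < m + k →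
      weightedHomogeneousComponent w m p ∈ I := by
    intro k
    induction k with
    | zero =>
      intro m hm
      rw [weightedHomogeneousComponent_eq_zero m p hm]
      exact I.zero_mem
    | succ k ih => exact fun m hm => step m (ih (m + 1) (by omega))
  rw [← sum_weightedHomogeneousComponent w p, finsum_eq_sum _ (weightedHomogeneousComponent_finsupp p)]
  exact I.sum_mem fun m _ => hall (weightedTotalDegree w p + 1) m (by omega)

lemma isWeightedHomogeneous_of_mem_supported [DecidableEq σ] {v : σ} {t : MvPolynomial σ K}
    (ht : t ∈ supported K ({v}ᶜ : Set σ)) : IsWeightedHomogeneous (Pi.single v (1 : ℕ)) t 0 := by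
  intro d hd
  rw [Finsupp.weight_apply, Finsupp.sum]
  refine Finset.sum_eq_zero fun i hi => ?_
  have : i ∈ t.vars := (mem_vars_iff_mem_support i).2 ⟨d, mem_support_iff.2 hd, hi⟩
  have hne : i ≠ v := fun h => by
    have := (mem_supported.1 ht) this
    simp [h] at this
  simp [Pi.single_eq_of_ne hne]

/-- If `r` is the remainder of `p` on division by `X v`, then `r * t` is still free of `X v`, so it
is the remainder of `p * t`. -/
lemma divMonomial_mul_of_mem_supported {v : σ} {t : MvPolynomial σ K}
    (ht : t ∈ supported K ({v}ᶜ : Set σ)) (p : MvPolynomial σ K) :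
    (p * t).divMonomial (Finsupp.single v 1) = p.divMonomial (Finsupp.single v 1) * t := by
  classical
  refine (eq_divMonomial_single (i := v) (r := p.modMonomial (Finsupp.single v 1) * t) ?_ ?_).symm
  · conv_lhs => rw [← divMonomial_add_modMonomial_single p v]
    ring
  · intro n hn
    obtain ⟨a, ha, b, hb, rfl⟩ := Finset.mem_add.1 (support_mul _ _ hn)
    have h1 : a v = 0 := by
      by_contra h
      refine mem_support_iff.1 ha (coeff_modMonomial_of_le p ?_)
      rw [Finsupp.single_le_iff]
      omega
    have h2 : b v = 0 := by
      by_contra h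
      have := (mem_supported.1 ht) ((mem_vars_iff_mem_support v).2 ⟨b, hb, Finsupp.mem_support_iff.2 h⟩)
      simp at this
    simp [h1, h2]

/-- A variable is a nonzerodivisor modulo an ideal whose generators do not involve it. -/
lemma mem_of_mul_X_mem {v : σ} {T : Set (MvPolynomial σ K)}
    (hT : ∀ t ∈ T, t ∈ supported K ({v}ᶜ : Set σ)) {p : MvPolynomial σ K}
    (hp : p * X v ∈ Ideal.span T) : p ∈ Ideal.span T := by
  -- Division by `X v` maps the ideal to itself; the factor `a` absorbs the coefficients met in the
  -- span induction.
  have key : ∀ q ∈ Ideal.span T, ∀ a : MvPolynomial σ K,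
      (a * q).divMonomial (Finsupp.single v 1) ∈ Ideal.span T := by
    intro q hq
    induction hq using Submodule.span_induction with
    | mem t ht =>
      intro a
      rw [divMonomial_mul_of_mem_supported (hT t ht) a]
      exact Ideal.mul_mem_left _ _ (Ideal.subset_span ht)
    | zero => simp [zero_divMonomial]
    | add a b _ _ ha hb =>
      intro c
      rw [mul_add, add_divMonomial]
      exact Ideal.add_mem _ (ha c) (hb c)
    | smul a b _ hb =>
      intro c
      rw [smul_eq_mul, ← mul_assoc]
      exact hb _
  simpa using key _ hp 1

lemma aeval_update_of_mem_supported [DecidableEq σ] {v : σ} {t : MvPolynomial σ K}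
    (ht : t ∈ supported K ({v}ᶜ : Set σ)) (c : MvPolynomial σ K) :
    aeval (Function.update X v c) t = t := by
  conv_rhs => rw [← aeval_X_left_apply t]
  refine eval₂Hom_congr' rfl (fun i hi _ => ?_) rfl
  have hne : i ≠ v := fun h => by simpa [h] using (mem_supported.1 ht) hi
  rw [Function.update_of_ne hne]

lemma X_dvd_sub_aeval_update [DecidableEq σ] (v : σ) (p : MvPolynomial σ K) :
    X v ∣ p - aeval (Function.update X v 0) p := by
  induction p using MvPolynomial.induction_on with
  | C a => simp
  | add p q hp hq =>
    rw [map_add, add_sub_add_comm]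
    exact dvd_add hp hq
  | mul_X p i hp =>
    rcases eq_or_ne i v with rfl | h
    · simp
    · rw [map_mul, aeval_X, Function.update_of_ne h, ← sub_mul]
      exact hp.mul_right _

/-- If `X v` and `a` are nonzerodivisors modulo an ideal `I` whose generators do not involve `v`,
and `a` does not involve `v` either, then `X v` is a nonzerodivisor modulo
`I + (a - X v * b)`. -/
lemma mem_sup_span_of_mul_X_mem {v : σ} {T : Set (MvPolynomial σ K)}
    (hT : ∀ t ∈ T, t ∈ supported K ({v}ᶜ : Set σ)) {a b : MvPolynomial σ K}
    (ha : a ∈ supported K ({v}ᶜ : Set σ)) (hreg : ∀ p, p * a ∈ Ideal.span T → p ∈ Ideal.span T)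
    {p : MvPolynomial σ K} (hp : p * X v ∈ Ideal.span T ⊔ Ideal.span {a - X v * b}) :
    p ∈ Ideal.span T ⊔ Ideal.span {a - X v * b} := by
  classical
  obtain ⟨i, hi, g, hg, hsum⟩ := Submodule.mem_sup.1 hp
  obtain ⟨h, rfl⟩ := Ideal.mem_span_singleton'.1 hg
  set ρ : MvPolynomial σ K →ₐ[K] MvPolynomial σ K := aeval (Function.update X v 0) with hρ
  have hρI : ∀ q ∈ Ideal.span T, ρ q ∈ Ideal.span T := by
    intro q hq
    refine (Ideal.span_le (I := (Ideal.span T).comap ρ)).2 (fun t ht => ?_) hq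
    change ρ t ∈ Ideal.span T
    rw [hρ, aeval_update_of_mem_supported (hT t ht)]
    exact Ideal.subset_span ht
  -- Setting `X v = 0` in `i + h * (a - X v * b) = p * X v` gives `ρ i + ρ h * a = 0`.
  have hρh : ρ h ∈ Ideal.span T := by
    apply hreg
    have h0 := congrArg ρ hsum
    have hv : ρ (X v) = 0 := by simp [hρ]
    have hρa : ρ a = a := aeval_update_of_mem_supported ha 0
    simp only [map_add, map_mul, map_sub, hv, hρa, zero_mul, sub_zero, mul_zero] at h0
    rw [eq_neg_of_add_eq_zero_right h0]
    exact neg_mem (hρI i hi)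
  obtain ⟨h', hh'⟩ := X_dvd_sub_aeval_update v h
  -- With `h = X v * h' + ρ h`, the multiple of `X v` can be moved to the left and `X v` cancelled
  -- modulo `I`.
  have hdiff : p - h' * (a - X v * b) ∈ Ideal.span T := by
    apply mem_of_mul_X_mem hT
    have : (p - h' * (a - X v * b)) * X v = i + ρ h * (a - X v * b) := by
      have e : h = X v * h' + ρ h := by rw [← hh']; ring
      rw [sub_mul, ← hsum]
      conv_lhs => rw [e]
      ring
    rw [this]
    exact add_mem hi (Ideal.mul_mem_right _ _ hρh)
  rw [← sub_add_cancel p (h' * (a - X v * b))]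
  exact add_mem (Ideal.mem_sup_left hdiff)
    (Ideal.mem_sup_right (Ideal.mem_span_singleton'.2 ⟨h', rfl⟩))

end Regular

/-! ### Adjacent minors form a regular sequence -/

section Minors

variable {σ : Type*} (K : Type*) [Field K] (x y : ℕ → σ)

/-- The 2-minor of the columns `j` and `j + 1` of the `2 × ∞` matrix with rows `x` and `y`. -/
noncomputable def adjacentMinor (j : ℕ) : MvPolynomial σ K :=
  X (x j) * X (y (j + 1)) - X (x (j + 1)) * X (y j)

/-- The ideal of the first `m` adjacent 2-minors. -/
noncomputable def adjacentMinorIdeal (m : ℕ) : Ideal (MvPolynomial σ K) :=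
  Ideal.span (adjacentMinor K x y '' Set.Iio m)

lemma adjacentMinorIdeal_zero : adjacentMinorIdeal K x y 0 = ⊥ := by
  simp [adjacentMinorIdeal]

lemma adjacentMinorIdeal_succ (m : ℕ) :
    adjacentMinorIdeal K x y (m + 1) =
      adjacentMinorIdeal K x y m ⊔ Ideal.span {adjacentMinor K x y m} := by
  have : Set.Iio (m + 1) = Set.Iio m ∪ {m} := by ext; simp
  rw [adjacentMinorIdeal, this, Set.image_union, Set.image_singleton, Ideal.span_union]
  rfl

lemma isHomogeneous_adjacentMinor (j : ℕ) : (adjacentMinor K x y j).IsHomogeneous 2 :=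
  ((isHomogeneous_X K _).mul (isHomogeneous_X K _)).sub
    ((isHomogeneous_X K _).mul (isHomogeneous_X K _))

lemma homogeneousComponent_mem_adjacentMinorIdeal {m : ℕ} {p : MvPolynomial σ K}
    (hp : p ∈ adjacentMinorIdeal K x y m) (k : ℕ) :
    homogeneousComponent k p ∈ adjacentMinorIdeal K x y m := by
  refine weightedHomogeneousComponent_mem_span ?_ hp k
  rintro _ ⟨j, -, rfl⟩
  exact ⟨2, isHomogeneous_adjacentMinor K x y j⟩

variable {K x y}

lemma adjacentMinor_mem_supported {v : σ} {j : ℕ} (h1 : x j ≠ v) (h2 : x (j + 1) ≠ v)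
    (h3 : y j ≠ v) (h4 : y (j + 1) ≠ v) :
    adjacentMinor K x y j ∈ supported K ({v}ᶜ : Set σ) :=
  sub_mem (mul_mem (X_mem_supported.2 h1) (X_mem_supported.2 h4))
    (mul_mem (X_mem_supported.2 h2) (X_mem_supported.2 h3))

variable {n : ℕ} (hx : ∀ i < n, ∀ j < n, x i = x j → i = j)
  (hy : ∀ i < n, ∀ j < n, y i = y j → i = j) (hxy : ∀ i < n, ∀ j < n, x i ≠ y j)

include hx hxy in
lemma adjacentMinor_mem_supported_x {m : ℕ} (hm : m + 1 < n) :
    ∀ t ∈ adjacentMinor K x y '' Set.Iio m, t ∈ supported K ({x (m + 1)}ᶜ : Set σ) := by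
  rintro _ ⟨j, hj, rfl⟩
  rw [Set.mem_Iio] at hj
  refine adjacentMinor_mem_supported (fun h => ?_) (fun h => ?_) (fun h => ?_) (fun h => ?_)
  · have := hx _ (by omega) _ (by omega) h; omega
  · have := hx _ (by omega) _ (by omega) h; omega
  · exact hxy _ (by omega) _ (by omega) h.symm
  · exact hxy _ (by omega) _ (by omega) h.symm

include hy hxy in
lemma adjacentMinor_mem_supported_y {m : ℕ} (hm : m + 1 < n) :
    ∀ t ∈ adjacentMinor K x y '' Set.Iio m, t ∈ supported K ({y (m + 1)}ᶜ : Set σ) := by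
  rintro _ ⟨j, hj, rfl⟩
  rw [Set.mem_Iio] at hj
  refine adjacentMinor_mem_supported (fun h => ?_) (fun h => ?_) (fun h => ?_) (fun h => ?_)
  · exact hxy _ (by omega) _ (by omega) h
  · exact hxy _ (by omega) _ (by omega) h
  · have := hy _ (by omega) _ (by omega) h; omega
  · have := hy _ (by omega) _ (by omega) h; omega

include hx hy hxy in
-- Modulo `x_{m+1}` the newest minor becomes `x_m y_{m+1}`, regular by induction and because
-- `y_{m+1}` is a fresh variable.
lemma mem_adjacentMinorIdeal_of_mul_X_mem {m : ℕ} (hm : m < n) {p : MvPolynomial σ K}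
    (hp : p * X (x m) ∈ adjacentMinorIdeal K x y m) : p ∈ adjacentMinorIdeal K x y m := by
  induction m generalizing p with
  | zero =>
    rw [adjacentMinorIdeal_zero, Ideal.mem_bot] at hp ⊢
    exact (mul_eq_zero.1 hp).resolve_right (X_ne_zero _)
  | succ m ih =>
    rw [adjacentMinorIdeal_succ] at hp ⊢
    refine mem_sup_span_of_mul_X_mem (adjacentMinor_mem_supported_x hx hxy hm) ?_ ?_ hp
    · exact mul_mem (X_mem_supported.2 fun h => by have := hx _ (by omega) _ hm h; omega)
        (X_mem_supported.2 fun h => hxy _ hm _ hm h.symm)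
    · intro q hq
      rw [mul_comm (X (x m)), ← mul_assoc] at hq
      exact mem_of_mul_X_mem (adjacentMinor_mem_supported_y hy hxy hm)
        (ih (by omega) (p := q * X (y (m + 1))) hq)

include hx hy hxy in
-- In the grading by degree in `y_{m+1}`, the ideal is generated in degree `0` and the minor has top
-- part `x_m y_{m+1}`.
lemma mem_adjacentMinorIdeal_of_mul_adjacentMinor_mem {m : ℕ} (hm : m + 1 < n)
    {p : MvPolynomial σ K} (hp : p * adjacentMinor K x y m ∈ adjacentMinorIdeal K x y m) :
    p ∈ adjacentMinorIdeal K x y m := by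
  classical
  have hT := adjacentMinor_mem_supported_y (K := K) hy hxy hm
  have hX : ∀ u, u ≠ y (m + 1) → IsWeightedHomogeneous (Pi.single (y (m + 1)) (1 : ℕ))
      (X u : MvPolynomial σ K) 0 := fun u hu =>
    isWeightedHomogeneous_of_mem_supported (X_mem_supported.2 hu)
  rw [adjacentMinor, sub_eq_add_neg] at hp
  refine mem_of_mul_add_mem (w := Pi.single (y (m + 1)) 1) (fun q hq k => ?_) ?_ ?_ ?_ hp
  · exact weightedHomogeneousComponent_mem_span
      (fun t ht => ⟨0, isWeightedHomogeneous_of_mem_supported (hT t ht)⟩) hq k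
  · have h := isWeightedHomogeneous_X K (Pi.single (y (m + 1)) 1) (y (m + 1))
    rw [Pi.single_eq_same] at h
    simpa using (hX (x m) (hxy _ (by omega) _ hm)).mul h
  · have h := (hX (x (m + 1)) (hxy _ hm _ hm)).mul
      (hX (y m) fun h => by have := hy _ (by omega) _ hm h; omega)
    simpa using h.neg
  · intro q hq
    rw [mul_comm (X (x m)), ← mul_assoc] at hq
    exact mem_of_mul_X_mem hT
      (mem_adjacentMinorIdeal_of_mul_X_mem hx hy hxy (by omega) (p := q * X (y (m + 1))) hq)

end Minors

end BinomialEdge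

namespace BinomialEdge

open MvPolynomial

/-! ### Hilbert series modulo a homogeneous nonzerodivisor -/

section HilbertFunction

variable {K σ : Type*} [Field K] [Finite σ]

instance finite_quotientGrading (I : Ideal (MvPolynomial σ K)) (k : ℕ) :
    Module.Finite K (quotientGrading I k) :=
  Module.Finite.iff_fg.2 ((homogeneousSubmodule_fg σ K k).map _)

omit [Finite σ] in
lemma mk_mem_quotientGrading (I : Ideal (MvPolynomial σ K)) {k : ℕ} {p : MvPolynomial σ K}
    (hp : p.IsHomogeneous k) : Ideal.Quotient.mk I p ∈ quotientGrading I k :=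
  ⟨p, hp, rfl⟩

lemma hilbertFunction_quotientGrading (I : Ideal (MvPolynomial σ K)) (k : ℕ) :
    hilbertFunction (quotientGrading I) k = Module.finrank K (quotientGrading I k) := by
  rw [hilbertFunction, Module.length_eq_finrank, ENat.toNat_natCast]

omit [Finite σ] in
lemma map_factor_quotientGrading {I J : Ideal (MvPolynomial σ K)} (h : I ≤ J) (k : ℕ) :
    (quotientGrading I k).map (Ideal.Quotient.factorₐ K h).toLinearMap = quotientGrading J k := by
  rw [quotientGrading, ← Submodule.map_comp]
  rfl

lemma finrank_quotientGrading_eq_add {I J : Ideal (MvPolynomial σ K)} (h : I ≤ J) (k : ℕ) :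
    Module.finrank K (quotientGrading I k) = Module.finrank K (quotientGrading J k) +
      Module.finrank K (quotientGrading I k ⊓
        LinearMap.ker (Ideal.Quotient.factorₐ K h).toLinearMap : Submodule K _) := by
  set φ := (Ideal.Quotient.factorₐ K h).toLinearMap
  rw [← LinearMap.finrank_range_add_finrank_ker (φ.domRestrict (quotientGrading I k)),
    LinearMap.range_domRestrict, map_factor_quotientGrading, LinearMap.ker_domRestrict,
    ← Submodule.map_comap_subtype, Submodule.finrank_map_subtype_eq]

variable {I : Ideal (MvPolynomial σ K)} (hI : ∀ p ∈ I, ∀ k, homogeneousComponent k p ∈ I)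
  {f : MvPolynomial σ K} {d : ℕ} (hf : f.IsHomogeneous d) (hreg : ∀ p, p * f ∈ I → p ∈ I)

include hI hf in
omit [Finite σ] in
lemma quotientGrading_inf_ker_of_lt {k : ℕ} (hk : k < d) :
    quotientGrading I k ⊓ LinearMap.ker
      (Ideal.Quotient.factorₐ K (le_sup_left : I ≤ I ⊔ Ideal.span {f})).toLinearMap = ⊥ := by
  rw [eq_bot_iff]
  rintro _ ⟨⟨p, hp, rfl⟩, hker⟩
  have hmem : p ∈ I ⊔ Ideal.span {f} := Ideal.Quotient.eq_zero_iff_mem.1 hker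
  obtain ⟨i, hi, g, hg, rfl⟩ := Submodule.mem_sup.1 hmem
  obtain ⟨h, rfl⟩ := Ideal.mem_span_singleton'.1 hg
  refine Ideal.Quotient.eq_zero_iff_mem.2 ?_
  have h1 : homogeneousComponent k (i + h * f) = i + h * f := homogeneousComponent_eq_self hp
  have h2 : homogeneousComponent k (h * f) = 0 := weightedHomogeneousComponent_mul_of_lt hf h hk
  rw [map_add, h2, add_zero] at h1
  rw [← h1]
  exact hI i hi k

include hI hf in
omit [Finite σ] in
-- Exactness in the middle of `(S/I)(-d) → S/I → S/(I + (f))`: in degree `k + d` a cofactor of `f`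
-- may be replaced by its component of degree `k`.
lemma quotientGrading_inf_ker_add (k : ℕ) :
    quotientGrading I (k + d) ⊓ LinearMap.ker
      (Ideal.Quotient.factorₐ K (le_sup_left : I ≤ I ⊔ Ideal.span {f})).toLinearMap =
    (quotientGrading I k).map (LinearMap.mulRight K (Ideal.Quotient.mk I f)) := by
  apply le_antisymm
  · rintro _ ⟨⟨p, hp, rfl⟩, hker⟩
    have hmem : p ∈ I ⊔ Ideal.span {f} := Ideal.Quotient.eq_zero_iff_mem.1 hker
    obtain ⟨i, hi, g, hg, rfl⟩ := Submodule.mem_sup.1 hmem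
    obtain ⟨h, rfl⟩ := Ideal.mem_span_singleton'.1 hg
    have h1 : homogeneousComponent (k + d) (i + h * f) = i + h * f :=
      homogeneousComponent_eq_self hp
    have h2 : homogeneousComponent (k + d) (h * f) = homogeneousComponent k h * f :=
      weightedHomogeneousComponent_mul_of_right hf h k
    refine ⟨_, mk_mem_quotientGrading I (homogeneousComponent_isHomogeneous k h), ?_⟩
    change Ideal.Quotient.mk I _ * Ideal.Quotient.mk I f = Ideal.Quotient.mk I (i + h * f)
    rw [← h1, map_add, h2, map_add, Ideal.Quotient.eq_zero_iff_mem.2 (hI i hi _), zero_add, map_mul]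
  · rintro _ ⟨_, ⟨p, hp, rfl⟩, rfl⟩
    refine ⟨⟨p * f, IsHomogeneous.mul hp hf, map_mul (Ideal.Quotient.mk I) _ _⟩, ?_⟩
    refine Ideal.Quotient.eq_zero_iff_mem.2 (?_ : p * f ∈ _)
    exact Ideal.mem_sup_right (Ideal.mem_span_singleton'.2 ⟨p, rfl⟩)

include hI hf in
lemma hilbertFunction_sup_span_of_lt {k : ℕ} (hk : k < d) :
    hilbertFunction (quotientGrading (I ⊔ Ideal.span {f})) k =
      hilbertFunction (quotientGrading I) k := by
  rw [hilbertFunction_quotientGrading, hilbertFunction_quotientGrading,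
    finrank_quotientGrading_eq_add (le_sup_left : I ≤ I ⊔ Ideal.span {f}),
    quotientGrading_inf_ker_of_lt hI hf hk, finrank_bot, add_zero]

include hI hf hreg in
lemma hilbertFunction_sup_span_add (k : ℕ) :
    hilbertFunction (quotientGrading I) (k + d) =
      hilbertFunction (quotientGrading (I ⊔ Ideal.span {f})) (k + d) +
        hilbertFunction (quotientGrading I) k := by
  have hinj : Function.Injective (LinearMap.mulRight K (Ideal.Quotient.mk I f)) := by
    rw [injective_iff_map_eq_zero]
    intro a ha
    obtain ⟨p, rfl⟩ := Ideal.Quotient.mk_surjective a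
    rw [LinearMap.mulRight_apply, ← map_mul, Ideal.Quotient.eq_zero_iff_mem] at ha
    exact Ideal.Quotient.eq_zero_iff_mem.2 (hreg p ha)
  simp only [hilbertFunction_quotientGrading]
  rw [finrank_quotientGrading_eq_add (le_sup_left : I ≤ I ⊔ Ideal.span {f}),
    quotientGrading_inf_ker_add hI hf,
    LinearEquiv.finrank_eq (Submodule.equivMapOfInjective _ hinj (quotientGrading I k))]

include hI hf hreg in
lemma hilbertSeries_sup_span :
    hilbertSeries (quotientGrading (I ⊔ Ideal.span {f})) =
      hilbertSeries (quotientGrading I) * (1 - PowerSeries.X ^ d) := by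
  ext k
  rw [mul_sub, mul_one, map_sub, PowerSeries.coeff_mul_X_pow']
  simp only [hilbertSeries, PowerSeries.coeff_mk]
  split_ifs with h
  · obtain ⟨k, rfl⟩ := Nat.exists_eq_add_of_le' h
    rw [hilbertFunction_sup_span_add hI hf hreg, Nat.add_sub_cancel]
    push_cast
    ring
  · rw [hilbertFunction_sup_span_of_lt hI hf (not_le.1 h), sub_zero]

lemma hilbertFunction_quotientGrading_bot (k : ℕ) :
    hilbertFunction (quotientGrading (⊥ : Ideal (MvPolynomial σ K))) k =
      (Nat.card σ + k - 1).choose k := by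
  classical
  have := Fintype.ofFinite σ
  have hinj : Function.Injective
      (Ideal.Quotient.mkₐ K (⊥ : Ideal (MvPolynomial σ K))).toLinearMap := by
    rw [injective_iff_map_eq_zero]
    exact fun a ha => Ideal.mem_bot.1 (Ideal.Quotient.eq_zero_iff_mem.1 ha)
  have e : {m : σ →₀ ℕ | m.degree = k} ≃ (Finset.univ : Finset σ).finsuppAntidiag k :=
    Equiv.subtypeEquivRight fun m => by
      simp [Finset.mem_finsuppAntidiag, Finsupp.degree_eq_sum]
  rw [hilbertFunction_quotientGrading, quotientGrading,
    ← LinearEquiv.finrank_eq (Submodule.equivMapOfInjective _ hinj _),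
    homogeneousSubmodule_eq_finsupp_supported,
    LinearEquiv.finrank_eq (AddMonoidAlgebra.supportedEquivFinsupp _),
    LinearEquiv.finrank_eq (Finsupp.domLCongr e), Module.finrank_finsupp_self, Fintype.card_coe,
    Finset.card_finsuppAntidiag_nat_eq_choose, Finset.card_univ, Nat.card_eq_fintype_card]

lemma hilbertSeries_quotientGrading_bot [Nonempty σ] :
    hilbertSeries (quotientGrading (⊥ : Ideal (MvPolynomial σ K))) *
      (1 - PowerSeries.X) ^ Nat.card σ = 1 := by
  obtain ⟨c, hc⟩ : ∃ c, Nat.card σ = c + 1 := Nat.exists_eq_succ_of_ne_zero Nat.card_pos.ne'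
  rw [hc]
  refine Eq.trans (congrArg (· * _) ?_) (PowerSeries.mk_add_choose_mul_one_sub_pow_eq_one ℚ c)
  refine PowerSeries.ext fun k => ?_
  rw [hilbertSeries, PowerSeries.coeff_mk, PowerSeries.coeff_mk,
    hilbertFunction_quotientGrading_bot, hc, show c + 1 + k - 1 = c + k by omega,
    Nat.choose_symm_add]

end HilbertFunction

/-! ### Hilbert series and dimension for adjacent minors -/

section Minors

variable {σ : Type*} {K : Type*} [Field K] {x y : ℕ → σ} [Finite σ] {n : ℕ}

lemma hilbertSeries_adjacentMinorIdeal (hx : ∀ i < n, ∀ j < n, x i = x j → i = j)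
    (hy : ∀ i < n, ∀ j < n, y i = y j → i = j) (hxy : ∀ i < n, ∀ j < n, x i ≠ y j)
    {m : ℕ} (hm : m < n) :
    hilbertSeries (quotientGrading (adjacentMinorIdeal K x y m)) *
      (1 - PowerSeries.X) ^ Nat.card σ = (1 - PowerSeries.X ^ 2) ^ m := by
  induction m with
  | zero =>
    have : Nonempty σ := ⟨x 0⟩
    rw [adjacentMinorIdeal_zero, hilbertSeries_quotientGrading_bot, pow_zero]
  | succ m ih =>
    rw [adjacentMinorIdeal_succ, hilbertSeries_sup_span
      (fun p hp k => homogeneousComponent_mem_adjacentMinorIdeal K x y hp k)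
      (isHomogeneous_adjacentMinor K x y m)
      (fun p => mem_adjacentMinorIdeal_of_mul_adjacentMinor_mem hx hy hxy hm), pow_succ _ m,
      ← ih (by omega)]
    ring

lemma ringKrullDim_quotient_adjacentMinorIdeal_le
    (hx : ∀ i < n, ∀ j < n, x i = x j → i = j)
    (hy : ∀ i < n, ∀ j < n, y i = y j → i = j) (hxy : ∀ i < n, ∀ j < n, x i ≠ y j)
    {m : ℕ} (hm : m < n) :
    ringKrullDim (MvPolynomial σ K ⧸ adjacentMinorIdeal K x y m) + m ≤ Nat.card σ := by
  induction m with
  | zero =>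
    refine le_trans (le_of_eq ?_) ((ringKrullDim_quotient_le (adjacentMinorIdeal K x y 0)).trans
      (MvPolynomial.ringKrullDim_of_isNoetherianRing (R := K) (ι := σ)).le) |>.trans ?_
    · simp
    · simp
  | succ m ih =>
    refine le_trans ?_ (ih (by omega))
    have hle : adjacentMinorIdeal K x y m ≤ adjacentMinorIdeal K x y (m + 1) := by
      rw [adjacentMinorIdeal_succ]; exact le_sup_left
    have hr : Ideal.Quotient.mk (adjacentMinorIdeal K x y m) (adjacentMinor K x y m) ∈
        nonZeroDivisors _ := by
      refine mem_nonZeroDivisors_iff_right.2 fun a ha => ?_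
      obtain ⟨p, rfl⟩ := Ideal.Quotient.mk_surjective a
      rw [← map_mul, Ideal.Quotient.eq_zero_iff_mem] at ha
      exact Ideal.Quotient.eq_zero_iff_mem.2
        (mem_adjacentMinorIdeal_of_mul_adjacentMinor_mem hx hy hxy hm ha)
    have := ringKrullDim_succ_le_of_surjective (Ideal.Quotient.factor hle)
      (Ideal.Quotient.factor_surjective hle) hr ?_
    · push_cast
      rw [add_comm (m : WithBot ℕ∞) 1, ← add_assoc]
      gcongr
    · refine Ideal.Quotient.eq_zero_iff_mem.2 (?_ : adjacentMinor K x y m ∈ _)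
      exact Ideal.subset_span ⟨m, by simp, rfl⟩

/-- The quotient of a polynomial ring in `X u, Y u` by the kernel of `X u ↦ s u, Y u ↦ t * s u` is a
domain of dimension at least one more than the number of the `u`. -/
lemma succ_le_ringKrullDim_quotient {τ : Type*} [Finite τ] [Nonempty τ]
    (J : Ideal (MvPolynomial (τ ⊕ τ) K))
    (hJ : ∀ p ∈ J, aeval (Sum.elim (fun u => X (some u)) (fun u => X none * X (some u))) p =
      (0 : MvPolynomial (Option τ) K)) :
    (Nat.card τ + 1 : WithBot ℕ∞) ≤ ringKrullDim (MvPolynomial (τ ⊕ τ) K ⧸ J) := by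
  set φ : MvPolynomial (τ ⊕ τ) K →ₐ[K] MvPolynomial (Option τ) K :=
    aeval (Sum.elim (fun u => X (some u)) (fun u => X none * X (some u))) with hφ
  let ψ : MvPolynomial (Option τ) K →ₐ[K] MvPolynomial τ K :=
    aeval (fun o => o.elim 0 X)
  have hsurj : Function.Surjective (ψ.comp φ) := by
    have : (ψ.comp φ).comp (rename Sum.inl) = AlgHom.id K (MvPolynomial τ K) := by
      ext u; simp [φ, ψ]
    intro p
    exact ⟨rename Sum.inl p, congrArg (fun g => g p) this⟩
  have hsurj' : Function.Surjective (ψ.comp φ.range.val) := by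
    intro p
    obtain ⟨q, hq⟩ := hsurj p
    exact ⟨⟨φ q, q, rfl⟩, hq⟩
  obtain ⟨u⟩ := ‹Nonempty τ›
  -- The image of `φ` is a domain. Its nonzero element `t * s_u` is killed by `ψ`, which sets `t =
  -- 0` and maps onto `K[s]`, so its dimension exceeds that of `K[s]`.
  have h1 := ringKrullDim_succ_le_of_surjective (ψ.comp φ.range.val).toRingHom hsurj'
    (r := ⟨φ (X (Sum.inr u)), _, rfl⟩) ?_ ?_
  · rw [MvPolynomial.ringKrullDim_of_isNoetherianRing, ringKrullDim_eq_zero_of_field, zero_add] at h1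
    refine h1.trans (ringKrullDim_le_of_surjective
      (Ideal.Quotient.lift J φ.rangeRestrict.toRingHom fun p hp => Subtype.ext (hJ p hp))
      (Ideal.Quotient.lift_surjective_of_surjective _ _ φ.rangeRestrict_surjective))
  · refine mem_nonZeroDivisors_of_ne_zero fun h => ?_
    have := congrArg Subtype.val h
    simp [φ, X_ne_zero] at this
  · change ψ (φ (X (Sum.inr u))) = 0
    simp [φ, ψ]

end Minors

end BinomialEdge

namespace BinomialEdge

/-! ### Hilbert polynomial and uniqueness of its coefficients -/

section HilbertPolynomial

lemma IsHilbertPolynomial.eq {K M : Type*} [Field K] [AddCommGroup M] [Module K M]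
    {ℳ : ℕ → Submodule K M} {P Q : Polynomial ℚ} (hP : IsHilbertPolynomial ℳ P)
    (hQ : IsHilbertPolynomial ℳ Q) : P = Q := by
  obtain ⟨N, hN⟩ := Filter.eventually_atTop.1 (hP.and hQ)
  refine Polynomial.eq_of_infinite_eval_eq P Q
    (((Set.Ici_infinite N).image Nat.cast_injective.injOn).mono ?_)
  rintro _ ⟨k, hk, rfl⟩
  exact (hN k hk).1.symm.trans (hN k hk).2

lemma linearIndependent_preHilbertPoly :
    LinearIndependent ℚ fun i : ℕ => Polynomial.preHilbertPoly ℚ i 0 := by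
  have hne : ∀ i, Polynomial.preHilbertPoly ℚ i 0 ≠ 0 := fun i h => by
    have := Polynomial.coeff_preHilbertPoly_self ℚ i 0
    rw [h, Polynomial.coeff_zero] at this
    exact inv_ne_zero (Nat.cast_ne_zero.2 i.factorial_ne_zero) this.symm
  let s : Polynomial.Sequence ℚ :=
    { elems' := fun i => Polynomial.preHilbertPoly ℚ i 0
      degree_eq' := fun i => by
        rw [Polynomial.degree_eq_natDegree (hne i), Polynomial.natDegree_preHilbertPoly] }
  exact s.linearIndependent

/-- The Hilbert polynomial determines the Hilbert coefficients. -/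
lemma sum_preHilbertPoly_injective (d : ℕ) :
    Function.Injective fun e : Fin d → ℤ =>
      ∑ i : Fin d, ((-1 : ℚ) ^ (Fin.rev i : ℕ) * (e (Fin.rev i) : ℚ)) •
        Polynomial.preHilbertPoly ℚ (i : ℕ) 0 := by
  intro e e' h
  have hli : LinearIndependent ℚ fun i : Fin d => Polynomial.preHilbertPoly ℚ (i : ℕ) 0 :=
    linearIndependent_preHilbertPoly.comp _ Fin.val_injective
  have h' := Fintype.linearIndependent_iff.1 hli
    (fun i => (-1 : ℚ) ^ (Fin.rev i : ℕ) * (e (Fin.rev i) : ℚ) -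
      (-1 : ℚ) ^ (Fin.rev i : ℕ) * (e' (Fin.rev i) : ℚ))
    (by simp only [sub_smul, Finset.sum_sub_distrib]; exact sub_eq_zero.2 h)
  funext j
  have := h' (Fin.rev j)
  rw [Fin.rev_rev, ← mul_sub] at this
  have := (mul_eq_zero.1 this).resolve_left (pow_ne_zero _ (by norm_num))
  exact_mod_cast sub_eq_zero.1 this

/-- A Hilbert series `(1 + t) ^ m / (1 - t) ^ (m + 2)` has coefficients given by a polynomial. -/
lemma coeff_eq_eval_of_mul_one_sub_pow_eq {m : ℕ} {H : PowerSeries ℚ}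
    (hH : H * (1 - PowerSeries.X) ^ (m + 2) = (1 + PowerSeries.X) ^ m) (k : ℕ) :
    PowerSeries.coeff k H = (∑ i : Fin (m + 2), ((-1 : ℚ) ^ (Fin.rev i : ℕ) *
      (((m.choose (Fin.rev i) : ℤ) * 2 ^ (m - (Fin.rev i : ℕ)) : ℤ) : ℚ)) •
        Polynomial.preHilbertPoly ℚ (i : ℕ) 0).eval (k : ℚ) := by
  -- Partial fractions from `1 + X = 2 - (1 - X)`: the `j`-th term has denominator `(1 - X)^(m + 2 -
  -- j)`.
  have hexp : H = ∑ j ∈ Finset.range (m + 1),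
      PowerSeries.C ((-1 : ℚ) ^ j * ((m.choose j : ℚ) * 2 ^ (m - j))) *
        PowerSeries.mk fun k => ((m + 1 - j + k).choose (m + 1 - j) : ℚ) := by
    have h0 : ((1 : PowerSeries ℚ) - PowerSeries.X) ^ (m + 2) ≠ 0 := by
      refine pow_ne_zero _ fun h => ?_
      simpa using congrArg PowerSeries.constantCoeff h
    refine mul_right_cancel₀ h0 ?_
    rw [hH, Finset.sum_mul, show (1 : PowerSeries ℚ) + PowerSeries.X =
      -(1 - PowerSeries.X) + PowerSeries.C 2 by rw [map_ofNat]; ring, add_pow]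
    refine Finset.sum_congr rfl fun j hj => ?_
    have hj' : j ≤ m := Nat.lt_succ_iff.1 (Finset.mem_range.1 hj)
    have h1 := PowerSeries.mk_add_choose_mul_one_sub_pow_eq_one ℚ (m + 1 - j)
    rw [show m + 2 = (m + 1 - j + 1) + j by omega, pow_add,
      mul_assoc (PowerSeries.C _) (PowerSeries.mk _), ← mul_assoc (PowerSeries.mk _), h1, one_mul, neg_pow]
    simp only [map_mul, map_pow, map_neg, map_one, map_natCast]
    ring
  rw [Polynomial.eval_finsetSum, hexp, map_sum,
    ← (Equiv.sum_comp Fin.revPerm _ : _ = ∑ i : Fin (m + 2), _)]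
  rw [Fin.sum_univ_castSucc, Finset.sum_range]
  -- The expansion has `m + 1` terms but the sum has `m + 2`; the extra one carries `m.choose (m +
  -- 1) = 0`, which is why `e_n = 0`.
  have hlast : ∀ z : ℚ, (-1 : ℚ) ^ ((Fin.revPerm (Fin.last (m + 1))).rev : ℕ) *
      (((m.choose (Fin.revPerm (Fin.last (m + 1))).rev : ℤ) *
        2 ^ (m - ((Fin.revPerm (Fin.last (m + 1))).rev : ℕ)) : ℤ) : ℚ) * z = 0 := by
    intro z; simp
  rw [Polynomial.eval_smul, smul_eq_mul, hlast, add_zero]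
  refine Finset.sum_congr rfl fun j _ => ?_
  rw [Polynomial.eval_smul, Polynomial.preHilbertPoly_eq_choose_sub_add ℚ _ (Nat.zero_le k),
    PowerSeries.coeff_C_mul, PowerSeries.coeff_mk, smul_eq_mul, Fin.revPerm_apply, Fin.rev_rev]
  simp only [Fin.val_castSucc, Fin.val_rev, Nat.sub_zero]
  rw [show m + 2 - (j + 1) = m + 1 - (j : ℕ) by omega, add_comm k]
  push_cast
  ring

end HilbertPolynomial

/-! ### The path graph -/

section Path

variable (K : Type*) [Field K] (n : ℕ) [NeZero n]

/-- Columns are indexed by `ℕ` to allow induction on their number; `Fin.ofNat` wraps modulo `n`, but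
the first `n - 1` minors only meet columns below `n`. -/
lemma binomialEdgeIdeal_pathGraph :
    binomialEdgeIdeal K (SimpleGraph.pathGraph n) =
      adjacentMinorIdeal K (fun i => Sum.inl (Fin.ofNat n i)) (fun i => Sum.inr (Fin.ofNat n i))
        (n - 1) := by
  have hof : ∀ i : Fin n, Fin.ofNat n (i : ℕ) = i := fun i => Fin.ext (Nat.mod_eq_of_lt i.2)
  rw [binomialEdgeIdeal, adjacentMinorIdeal]
  congr 1
  ext f
  constructor
  · rintro ⟨i, j, hij, hadj, rfl⟩
    have hj : (i : ℕ) + 1 = j := by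
      rcases SimpleGraph.pathGraph_adj.1 hadj with h | h
      · exact h
      · rw [Fin.lt_def] at hij; omega
    refine ⟨i, ?_, ?_⟩
    · have := j.2
      rw [Set.mem_Iio]; omega
    · rw [adjacentMinor, hj, hof, hof]
  · rintro ⟨k, hk, rfl⟩
    rw [Set.mem_Iio] at hk
    have h1 : ((Fin.ofNat n k : Fin n) : ℕ) = k := Nat.mod_eq_of_lt (by omega)
    have h2 : ((Fin.ofNat n (k + 1) : Fin n) : ℕ) = k + 1 := Nat.mod_eq_of_lt (by omega)
    refine ⟨Fin.ofNat n k, Fin.ofNat n (k + 1), ?_, SimpleGraph.pathGraph_adj.2 (Or.inl ?_), rfl⟩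
    · rw [Fin.lt_def]; omega
    · omega

variable {n} in
lemma ofNat_injOn : ∀ i < n, ∀ j < n, Fin.ofNat n i = Fin.ofNat n j → i = j := by
  intro i hi j hj h
  have := congrArg Fin.val h
  simpa [Nat.mod_eq_of_lt hi, Nat.mod_eq_of_lt hj] using this

lemma hilbertSeries_binomialEdgeIdeal_pathGraph_mul :
    hilbertSeries (quotientGrading (binomialEdgeIdeal K (SimpleGraph.pathGraph n))) *
      (1 - PowerSeries.X) ^ (n + 1) = (1 + PowerSeries.X) ^ (n - 1) := by
  have hn := NeZero.pos n
  have h := hilbertSeries_adjacentMinorIdeal (K := K) (n := n) (m := n - 1)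
    (x := fun i => Sum.inl (Fin.ofNat n i)) (y := fun i => Sum.inr (Fin.ofNat n i))
    (fun i hi j hj h => ofNat_injOn i hi j hj (Sum.inl_injective h))
    (fun i hi j hj h => ofNat_injOn i hi j hj (Sum.inr_injective h))
    (fun i _ j _ => Sum.inl_ne_inr) (by omega)
  have h0 : ((1 : PowerSeries ℚ) - PowerSeries.X) ^ (n - 1) ≠ 0 := by
    refine pow_ne_zero _ fun h => ?_
    simpa using congrArg PowerSeries.constantCoeff h
  rw [← binomialEdgeIdeal_pathGraph, Nat.card_sum, Nat.card_fin,
    show n + n = (n + 1) + (n - 1) by omega, pow_add, ← mul_assoc,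
    show (1 : PowerSeries ℚ) - PowerSeries.X ^ 2 = (1 + PowerSeries.X) * (1 - PowerSeries.X) by ring,
    mul_pow] at h
  exact mul_right_cancel₀ h0 h

lemma supportDim_binomialEdgeIdeal_pathGraph :
    Module.supportDim (MvPolynomial (Fin n ⊕ Fin n) K)
      (MvPolynomial (Fin n ⊕ Fin n) K ⧸ binomialEdgeIdeal K (SimpleGraph.pathGraph n)) =
        (n + 1 : ℕ) := by
  have hn := NeZero.pos n
  rw [Module.supportDim_quotient_eq_ringKrullDim]
  apply le_antisymm
  · have h := ringKrullDim_quotient_adjacentMinorIdeal_le (K := K) (n := n) (m := n - 1)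
      (x := fun i => Sum.inl (Fin.ofNat n i)) (y := fun i => Sum.inr (Fin.ofNat n i))
      (fun i hi j hj h => ofNat_injOn i hi j hj (Sum.inl_injective h))
      (fun i hi j hj h => ofNat_injOn i hi j hj (Sum.inr_injective h))
      (fun i _ j _ => Sum.inl_ne_inr) (by omega)
    rw [← binomialEdgeIdeal_pathGraph, Nat.card_sum, Nat.card_fin,
      show n + n = (n + 1) + (n - 1) by omega, Nat.cast_add (n + 1)] at h
    exact ENat.WithBot.add_le_add_natCast_right_iff.1 h
  · have h := succ_le_ringKrullDim_quotient (binomialEdgeIdeal K (SimpleGraph.pathGraph n)) ?_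
    · simpa using h
    · intro p hp
      refine (Ideal.span_le (I := RingHom.ker (MvPolynomial.aeval (R := K) _))).2 ?_ hp
      -- The rows `s` and `t * s` are proportional, so every 2-minor vanishes.
      rintro _ ⟨i, j, -, -, rfl⟩
      simp only [SetLike.mem_coe, RingHom.mem_ker, map_sub, map_mul, MvPolynomial.aeval_X,
        Sum.elim_inl, Sum.elim_inr]
      ring

end Path

end BinomialEdge

/-- For the path `P_n` on `n ≥ 1` vertices, with `S = K[x_1, …, x_n, y_1, …, y_n]`, the Hilbert
series of `S / J_{P_n}`, and its Hilbert coefficients `e_0, …, e_n`: a family `e` is the family of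
Hilbert coefficients (of a module of dimension `n + 1`) if and only if it is given by the stated
formulas. -/
theorem corollary3p6 {K : Type*} [Field K] (n : ℕ) (hn : 1 ≤ n) :
    BinomialEdge.hilbertSeries
        (BinomialEdge.quotientGrading
          (BinomialEdge.binomialEdgeIdeal K (SimpleGraph.pathGraph n))) =
      (1 + PowerSeries.X) ^ (n - 1) * ((1 - PowerSeries.X) ^ (n + 1))⁻¹ ∧
    ∀ e : Fin (n + 1) → ℤ,
      BinomialEdge.IsHilbertCoefficients (MvPolynomial (Fin n ⊕ Fin n) K)
        (BinomialEdge.quotientGrading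
          (BinomialEdge.binomialEdgeIdeal K (SimpleGraph.pathGraph n))) e ↔
        (∀ i : Fin (n + 1), (i : ℕ) ≤ n - 1 →
          e i = ((n - 1).choose (i : ℕ) : ℤ) * 2 ^ (n - 1 - (i : ℕ))) ∧
        e (Fin.last n) = 0 := by
  obtain ⟨m, rfl⟩ : ∃ m, n = m + 1 := Nat.exists_eq_add_of_le' hn
  have hH := BinomialEdge.hilbertSeries_binomialEdgeIdeal_pathGraph_mul K (m + 1)
  refine ⟨(PowerSeries.eq_mul_inv_iff_mul_eq (by simp)).2 hH, fun e => ?_⟩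
  have hpoly : BinomialEdge.IsHilbertPolynomial _ _ := Filter.Eventually.of_forall fun k =>
    (PowerSeries.coeff_mk k _).symm.trans
      (BinomialEdge.coeff_eq_eval_of_mul_one_sub_pow_eq (m := m) hH k)
  rw [BinomialEdge.IsHilbertCoefficients,
    and_iff_right (BinomialEdge.supportDim_binomialEdgeIdeal_pathGraph K (m + 1))]
  have hiff : (BinomialEdge.IsHilbertPolynomial _ _) ↔ e = fun i : Fin (m + 2) =>
      (m.choose (i : ℕ) : ℤ) * 2 ^ (m - (i : ℕ)) :=
    ⟨fun h => BinomialEdge.sum_preHilbertPoly_injective (m + 2) (h.eq hpoly),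
      fun h => by subst h; exact hpoly⟩
  rw [hiff, funext_iff]
  constructor
  · exact fun h => ⟨fun i _ => h i, by simpa using h (Fin.last (m + 1))⟩
  · rintro ⟨h1, h2⟩ i
    rcases Nat.lt_or_ge m i with hi | hi
    · obtain rfl : i = Fin.last (m + 1) := Fin.ext (by have := i.2; rw [Fin.val_last]; omega)
      simpa using h2
    · exact h1 i hi
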